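/- Let $K$ be a field and $G$ a finite group. For a representation $G\to \mathrm{GL}(V)$ on a finite dimensional $K$-vector space $V$, let $K[V]$ be the (polynomial) coordinate ring of $V$, graded by degree, with the induced action of $G$, let $K[V]^G$ be the algebra of $G$-invariant polynomials, and let $K[V]^G_{\le d}$ be the set of those of degree at most $d$. Let $\beta_{\mathrm{sep}}(G,V)$ be the minimal $d\in\mathbb{N}_0$ such that, for all $v,w\in V$, if $f(v)=f(w)$ for all $f\in K[V]^G_{\le d}$ then $v$ and $w$ have the same $G$-orbit. Let $\beta_{\mathrm{sep}}^K(G)$ be the supremum of $\beta_{\mathrm{sep}}(G,V)$ over all finite dimensional representations $V$ of $G$ over $K$. **Proposition.** Let $G$ be a finite abelian group and let $K$ be a field whose characteristic does not divide $|G|$. Then $$\beta_{\mathrm{sep}}^K(G)\le \beta_{\mathrm{sep}}^{\mathbb{C}}(G),$$ and equality holds whenever $K$ contains an element whose multiplicative order equals the exponent of $G$. -/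

import Mathlib

open scoped Matrix

noncomputable section

namespace SepNoether

variable {K : Type*} [Field K] {G : Type*} [Group G] {n : ℕ}

/-- The substitution `f(x) ↦ f(A x)` on `K[x_1, …, x_n]`: the `K`-algebra endomorphism with
`x_j ↦ ∑ i, A j i * x_i`. -/
def linSubst (A : Matrix (Fin n) (Fin n) K) :
    MvPolynomial (Fin n) K →ₐ[K] MvPolynomial (Fin n) K :=
  MvPolynomial.aeval fun j => ∑ i, MvPolynomial.C (A j i) * MvPolynomial.X i

/-- The algebra `K[V]^G` of polynomial invariants of the representation `ψ : G → GL_n(K)` on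
`V = K^n` (column vectors). The group acts on `K[V] = K[x_1, …, x_n]` by `K`-algebra automorphisms
with `g • x_j = ∑ i, ψ(g⁻¹) j i * x_i`. -/
def invariants (ψ : G →* GL (Fin n) K) : Subalgebra K (MvPolynomial (Fin n) K) where
  carrier := {f | ∀ g : G, linSubst (ψ g⁻¹ : Matrix (Fin n) (Fin n) K) f = f}
  mul_mem' ha hb g := by rw [map_mul, ha g, hb g]
  add_mem' ha hb g := by rw [map_add, ha g, hb g]
  algebraMap_mem' r g := AlgHom.commutes _ r

/-- `K[V]^G_{≤ d}`: the invariants all of whose homogeneous components have degree at most `d`. -/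
def invariantsLE (ψ : G →* GL (Fin n) K) (d : ℕ) : Set (MvPolynomial (Fin n) K) :=
  {f | f ∈ invariants ψ ∧ f.totalDegree ≤ d}

/-- `S ⊆ K[V]^G` is a separating set: if all elements of `S` agree on `v` and `w`, then
`v` and `w` have the same `G`-orbit. -/
def IsSeparatingSet (ψ : G →* GL (Fin n) K) (S : Set (MvPolynomial (Fin n) K)) : Prop :=
  S ⊆ invariants ψ ∧
    ∀ v w : Fin n → K, (∀ f ∈ S, MvPolynomial.eval v f = MvPolynomial.eval w f) →
      ∃ g : G, (ψ g : Matrix (Fin n) (Fin n) K) *ᵥ v = w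

/-- `β_sep(G, V)`: the minimal `d` such that `K[V]^G_{≤ d}` is a separating set
(by convention `⊤` if there were no such `d`). -/
def betaSepRep (ψ : G →* GL (Fin n) K) : ℕ∞ :=
  ⨅ (d : ℕ) (_ : IsSeparatingSet ψ (invariantsLE ψ d)), (d : ℕ∞)

/-- The separating Noether number `β_sep^K(G)`: the supremum of `β_sep(G, V)` over all finite
dimensional `K G`-modules `V`. Every such module is, after a choice of basis, given by a
homomorphism `G → GL_n(K)` for some `n`. -/
def betaSep (K : Type*) [Field K] (G : Type*) [Group G] : ℕ∞ :=
  ⨆ (n : ℕ) (ψ : G →* GL (Fin n) K), betaSepRep ψ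

end SepNoether

end

/-!
Write `e` for the exponent of `G` and call a field split if it contains a primitive `e`-th root of
unity.

* Extending scalars from `K` to its algebraic closure `L` does not decrease the separating Noether
  number (`betaSep_le_betaSep_of_algebra`): since `|G|` is invertible, an `L`-invariant of degree at
  most `d` is an `L`-linear combination of transfers of monomials, which are `K`-invariants of
  degree at most `d`. So `K`-rational points that are not separated over `K` are not separated
  over `L`.
* Two split fields `K`, `F` of characteristic prime to `|G|` have the same separating Noether
  number (`betaSep_le_betaSep_of_hasEnoughRootsOfUnity` in both directions). A representation over
  `K` is diagonal in a suitable basis, with characters `χ i` (`exists_diagonalization`), and its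
  invariants are spanned by the monomials `x^a` with `∏ i, χ i ^ a i = 1`. If the invariants of
  degree at most `d` separate orbits in all representations over `F`, then `d` is at least the order
  of every character (`orderOf_character_le`). Hence two points `x`, `y` that agree on the invariant
  monomials of degree at most `d` have the same support, and `y i = u i * x i` for roots of unity
  `u i`. That `x`, `y` agree on an invariant monomial supported where `x` is nonzero means that
  `∏ i, u i ^ a i = 1`, and that they lie in one orbit means that some `g` satisfies `χ i g = u i`
  wherever `x i` is nonzero. Both conditions live in the group of `e`-th roots of unity, so an
  isomorphism with the corresponding group of `F` carries them to a diagonal representation over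
  `F`, where the second follows from the first.

The inequality follows by comparing `K` with its algebraic closure and that with `ℂ`; if `K` is
itself split, `ℂ` and `K` can be compared directly.
-/

open scoped Matrix

noncomputable section

namespace SepNoether

open MvPolynomial

/-! ### Linear substitutions -/

section LinSubst

variable {K : Type*} [Field K] {n : ℕ}

lemma linSubst_X (A : Matrix (Fin n) (Fin n) K) (j : Fin n) :
    linSubst A (X j) = ∑ i, C (A j i) * X i := by
  simp [linSubst]

lemma eval_linSubst (A : Matrix (Fin n) (Fin n) K) (v : Fin n → K)
    (f : MvPolynomial (Fin n) K) : eval v (linSubst A f) = eval (A *ᵥ v) f := by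
  have h : ((aeval v : MvPolynomial (Fin n) K →ₐ[K] K).comp (linSubst A)) = aeval (A *ᵥ v) := by
    ext j
    simp [linSubst_X, Matrix.mulVec, dotProduct]
  simpa [aeval_eq_eval] using DFunLike.congr_fun h f

lemma linSubst_linSubst (A B : Matrix (Fin n) (Fin n) K) (f : MvPolynomial (Fin n) K) :
    linSubst A (linSubst B f) = linSubst (B * A) f := by
  have h : (linSubst A).comp (linSubst B) = linSubst (B * A) := by
    refine algHom_ext fun j => ?_
    simp only [AlgHom.comp_apply, linSubst_X, map_sum, map_mul, Matrix.mul_apply, Finset.sum_mul,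
      Finset.mul_sum, mul_assoc]
    rw [Finset.sum_comm]
    simp [linSubst]
  exact DFunLike.congr_fun h f

lemma totalDegree_linSubst_le (A : Matrix (Fin n) (Fin n) K) (f : MvPolynomial (Fin n) K) :
    (linSubst A f).totalDegree ≤ f.totalDegree := by
  rw [linSubst, aeval_def, eval₂_eq']
  refine totalDegree_finsetSum_le fun a ha => ?_
  refine (totalDegree_mul _ _).trans ?_
  rw [algebraMap_eq, totalDegree_C, zero_add]
  refine (totalDegree_finsetProd _ _).trans (le_trans ?_ (le_totalDegree ha))
  rw [Finsupp.sum_fintype _ _ fun _ => rfl]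
  refine Finset.sum_le_sum fun i _ => (totalDegree_pow _ _).trans ?_
  have h : (∑ j, C (A i j) * X j : MvPolynomial (Fin n) K).totalDegree ≤ 1 :=
    totalDegree_finsetSum_le fun j _ => (totalDegree_mul _ _).trans (by simp)
  simpa using Nat.mul_le_mul_left (a i) h

lemma map_linSubst {L : Type*} [Field L] (φ : K →+* L) (A : Matrix (Fin n) (Fin n) K)
    (f : MvPolynomial (Fin n) K) : map φ (linSubst A f) = linSubst (A.map φ) (map φ f) := by
  induction f using MvPolynomial.induction_on with
  | C a => simp [linSubst]
  | add p q hp hq => simp [hp, hq]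
  | mul_X p i hp => simp [hp, linSubst_X]

/-- A diagonal substitution multiplies the monomial `x^a` by `d^a`. -/
lemma coeff_linSubst_diagonal (d : Fin n → K) (f : MvPolynomial (Fin n) K) (a : Fin n →₀ ℕ) :
    coeff a (linSubst (Matrix.diagonal d) f) = (∏ i, d i ^ a i) * coeff a f := by
  have h : ∀ j, linSubst (Matrix.diagonal d) (X j) = C (d j) * X j := fun j => by
    rw [linSubst_X, Finset.sum_eq_single j] <;> simp +contextual [eq_comm]
  have hm : ∀ (b : Fin n →₀ ℕ) (c : K), linSubst (Matrix.diagonal d) (monomial b c) =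
      monomial b ((∏ i, d i ^ b i) * c) := fun b c => by
    rw [monomial_eq, Finsupp.prod_fintype _ _ (by simp), map_mul, map_prod, monomial_eq,
      Finsupp.prod_fintype _ _ (by simp)]
    simp only [map_pow, h, mul_pow, Finset.prod_mul_distrib, map_mul, map_prod]
    rw [show linSubst (Matrix.diagonal d) (C c) = C c from AlgHom.commutes _ c]
    ring
  conv_lhs => rw [f.as_sum]
  rw [map_sum, coeff_sum]
  simp only [hm, coeff_monomial]
  rw [Finset.sum_ite_eq' f.support a]
  split_ifs with ha
  · rfl
  · rw [notMem_support_iff.mp ha, mul_zero]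

end LinSubst

/-! ### Separation in bounded degree -/

section Separating

variable {K : Type*} [Field K] {G : Type*} [Group G] {n : ℕ}

lemma invariantsLE_mono (ψ : G →* GL (Fin n) K) {d e : ℕ} (h : d ≤ e) :
    invariantsLE ψ d ⊆ invariantsLE ψ e := fun _ hf => ⟨hf.1, hf.2.trans h⟩

/-- The infimum defining `β_sep(G, V)` is attained, and separation persists in higher degrees. -/
lemma betaSepRep_le_coe_iff (ψ : G →* GL (Fin n) K) (d : ℕ) :
    betaSepRep ψ ≤ d ↔ IsSeparatingSet ψ (invariantsLE ψ d) := by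
  refine ⟨fun h => ?_, fun h => iInf₂_le d h⟩
  by_contra hd
  have : ((d + 1 : ℕ) : ℕ∞) ≤ betaSepRep ψ := by
    refine le_iInf₂ fun k hk => ?_
    rw [Nat.cast_le]
    by_contra hlt
    exact hd ⟨fun f hf => hf.1, fun v w hvw => hk.2 v w fun f hf =>
      hvw f (invariantsLE_mono ψ (by omega) hf)⟩
  have := Nat.cast_le.mp (this.trans h)
  omega

/-- To compare separating Noether numbers it suffices to transfer, degree by degree, the property
that the invariants of degree at most `d` separate orbits in every representation. -/
lemma betaSep_le_betaSep_of_forall {F : Type*} [Field F]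
    (h : ∀ d : ℕ, (∀ (m : ℕ) (φ : G →* GL (Fin m) F), IsSeparatingSet φ (invariantsLE φ d)) →
      ∀ (n : ℕ) (ψ : G →* GL (Fin n) K) (v w : Fin n → K),
        (∀ f ∈ invariantsLE ψ d, eval v f = eval w f) →
          ∃ g : G, (ψ g : Matrix (Fin n) (Fin n) K) *ᵥ v = w) :
    betaSep K G ≤ betaSep F G := by
  refine iSup₂_le fun n ψ => ?_
  rcases eq_or_ne (betaSep F G) ⊤ with htop | htop
  · rw [htop]; exact le_top
  · obtain ⟨d, hd⟩ := ENat.ne_top_iff_exists.mp htop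
    rw [← hd, betaSepRep_le_coe_iff]
    refine ⟨fun f hf => hf.1, h d (fun m φ => ?_) n ψ⟩
    rw [← betaSepRep_le_coe_iff, hd]
    exact le_iSup₂ (f := fun (m : ℕ) (φ : G →* GL (Fin m) F) => betaSepRep φ) m φ

end Separating

/-! ### Extension of scalars -/

section BaseChange

variable {K : Type*} [Field K] {G : Type*} [Group G] {n : ℕ}

/-- The sum of the `G`-translates of a polynomial (the Reynolds operator without its
factor `1 / |G|`). -/
def transfer [Fintype G] (ψ : G →* GL (Fin n) K) (f : MvPolynomial (Fin n) K) :
    MvPolynomial (Fin n) K :=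
  ∑ g : G, linSubst (ψ g : Matrix (Fin n) (Fin n) K) f

lemma transfer_mem_invariantsLE [Fintype G] (ψ : G →* GL (Fin n) K) {f : MvPolynomial (Fin n) K}
    {d : ℕ} (hf : f.totalDegree ≤ d) : transfer ψ f ∈ invariantsLE ψ d := by
  refine ⟨fun g => ?_, totalDegree_finsetSum_le fun g _ => (totalDegree_linSubst_le _ _).trans hf⟩
  simp only [transfer, map_sum, linSubst_linSubst, ← Units.val_mul, ← map_mul]
  exact Fintype.sum_equiv (Equiv.mulRight g⁻¹) _ _ fun _ => rfl

/-- Scalar extension does not lower the separating Noether number in the non-modular case: by the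
transfer, the invariants over `L` of degree at most `d` are spanned by invariants over `K`. -/
theorem betaSep_le_betaSep_of_algebra (K L : Type*) [Field K] [Field L] [Algebra K L] [Finite G]
    (hK : (Nat.card G : K) ≠ 0) : betaSep K G ≤ betaSep L G := by
  have := Fintype.ofFinite G
  refine betaSep_le_betaSep_of_forall fun d hd n ψ v w hvw => ?_
  let ι := algebraMap K L
  let ψL : G →* GL (Fin n) L := (Matrix.GeneralLinearGroup.map ι).comp ψ
  have hψL : ∀ g, (ψL g : Matrix (Fin n) (Fin n) L) = (ψ g : Matrix (Fin n) (Fin n) K).map ι :=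
    fun g => rfl
  have hL : (Fintype.card G : L) ≠ 0 := by
    rw [← Nat.card_eq_fintype_card, ← map_natCast ι]
    exact (map_ne_zero ι).mpr hK
  -- The value of an invariant at a `K`-rational point, in terms of invariants over `K`.
  have key : ∀ f ∈ invariantsLE ψL d, ∀ u : Fin n → K, (Fintype.card G : L) * eval (ι ∘ u) f =
      ∑ a ∈ f.support, coeff a f * ι (eval u (transfer ψ (monomial a 1))) := by
    intro f hf u
    have h1 : ∀ g, linSubst (ψL g : Matrix (Fin n) (Fin n) L) f = f := fun g => by
      simpa using hf.1 g⁻¹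
    have h2 : ∀ g, eval (ι ∘ u) f = ∑ a ∈ f.support,
        coeff a f * ι (eval u (linSubst (ψ g : Matrix (Fin n) (Fin n) K) (monomial a 1))) := by
      intro g
      conv_lhs => rw [← h1 g, f.as_sum, map_sum, map_sum]
      refine Finset.sum_congr rfl fun a _ => ?_
      rw [show ι (eval u _) = eval (ι ∘ u) (map ι _) from MvPolynomial.map_eval ι u _, map_linSubst, ← hψL, map_monomial, map_one,
        ← mul_one (coeff a f), ← C_mul_monomial, map_mul, map_mul,
        show linSubst _ (C (coeff a f)) = C (coeff a f) from AlgHom.commutes _ _, eval_C, mul_one]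
    simp only [transfer, map_sum, Finset.mul_sum]
    rw [Finset.sum_comm, ← Finset.sum_congr rfl fun g _ => h2 g]
    simp
  obtain ⟨g, hg⟩ := (hd n ψL).2 (ι ∘ v) (ι ∘ w) fun f hf => by
    refine mul_left_cancel₀ hL ?_
    rw [key f hf v, key f hf w]
    refine Finset.sum_congr rfl fun a ha => ?_
    rw [hvw _ (transfer_mem_invariantsLE ψ ?_)]
    exact (totalDegree_monomial_le _ _).trans ((le_totalDegree ha).trans hf.2)
  refine ⟨g, funext fun i => ι.injective ?_⟩
  have := congrFun hg i
  rw [hψL] at this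
  rw [RingHom.map_mulVec]
  exact this

end BaseChange

/-! ### Diagonalization of abelian groups -/

section Diagonalization

variable {K : Type*} [Field K] {G : Type*} [CommGroup G] [Finite G]
  [HasEnoughRootsOfUnity K (Monoid.exponent G)]

lemma sum_character_apply_eq_zero [Fintype (G →* Kˣ)] {g : G} (hg : g ≠ 1) :
    ∑ χ : G →* Kˣ, (χ g : K) = 0 := by
  obtain ⟨θ, hθ⟩ := CommGroup.exists_apply_ne_one_of_hasEnoughRootsOfUnity G K hg
  have h : (θ g : K) * ∑ χ : G →* Kˣ, (χ g : K) = ∑ χ : G →* Kˣ, (χ g : K) := by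
    rw [Finset.mul_sum]
    exact Fintype.sum_equiv (Equiv.mulLeft θ) _ _ fun χ => by simp
  have h' : ((θ g : K) - 1) * ∑ χ : G →* Kˣ, (χ g : K) = 0 := by rw [sub_mul, h]; ring
  exact (mul_eq_zero.mp h').resolve_left (sub_ne_zero.mpr fun h1 => hθ (Units.ext h1))

/-- In the non-modular split case the weight vectors of a representation of a finite abelian group
span: `|G| x` is the sum over all characters `χ` of `∑ g, χ(g⁻¹) g x`. -/
lemma span_weightVectors_eq_top {V : Type*} [AddCommGroup V] [Module K V]
    (hK : (Nat.card G : K) ≠ 0) (ρ : G →* Module.End K V) :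
    Submodule.span K {x : V | ∃ χ : G →* Kˣ, ∀ g, ρ g x = (χ g : K) • x} = ⊤ := by
  have := Fintype.ofFinite G
  have := Fintype.ofFinite (G →* Kˣ)
  rw [eq_top_iff]
  intro x _
  have hsum : ∑ χ : G →* Kˣ, ∑ g : G, (χ g⁻¹ : K) • ρ g x = (Nat.card G : K) • x := by
    rw [Finset.sum_comm]
    simp_rw [← Finset.sum_smul]
    rw [Finset.sum_eq_single (1 : G)]
    · rw [← CommGroup.card_monoidHom_of_hasEnoughRootsOfUnity G K, Nat.card_eq_fintype_card]
      simp
    · intro g _ hg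
      rw [sum_character_apply_eq_zero (inv_ne_one.mpr hg), zero_smul]
    · simp
  have hx : x = (Nat.card G : K)⁻¹ • ∑ χ : G →* Kˣ, ∑ g : G, (χ g⁻¹ : K) • ρ g x := by
    rw [hsum, inv_smul_smul₀ hK]
  rw [hx]
  refine Submodule.smul_mem _ _ (Submodule.sum_mem _ fun χ _ => Submodule.subset_span ⟨χ, ?_⟩)
  intro h
  rw [map_sum, Finset.smul_sum]
  refine Fintype.sum_equiv (Equiv.mulLeft h) _ _ fun g => ?_
  simp only [Equiv.coe_mulLeft, map_mul, Module.End.mul_apply, map_smul, smul_smul, mul_inv_rev,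
    Units.val_mul]
  congr 1
  rw [mul_comm, mul_assoc, ← Units.val_mul, ← map_mul, inv_mul_cancel, map_one, Units.val_one,
    mul_one]

/-- A representation of a finite abelian group over a field with enough roots of unity, of
characteristic prime to `|G|`, is diagonalizable. -/
lemma exists_diagonalization {n : ℕ} (hK : (Nat.card G : K) ≠ 0) (ψ : G →* GL (Fin n) K) :
    ∃ (P Q : Matrix (Fin n) (Fin n) K) (χ : Fin n → G →* Kˣ), P * Q = 1 ∧ Q * P = 1 ∧
      ∀ g, Q * (ψ g : Matrix (Fin n) (Fin n) K) = Matrix.diagonal (fun i => (χ i g : K)) * Q := by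
  let ρ : G →* Module.End K (Fin n → K) :=
    (Matrix.toLinAlgEquiv' : Matrix (Fin n) (Fin n) K ≃ₐ[K] _).toAlgHom.toMonoidHom.comp
      ((Units.coeHom _).comp ψ)
  have hρ : ∀ g x, ρ g x = (ψ g : Matrix (Fin n) (Fin n) K) *ᵥ x := fun g x => rfl
  have hspan := (span_weightVectors_eq_top hK ρ).ge
  let b₀ := Module.Basis.ofSpan hspan
  let b := b₀.reindex (b₀.indexEquiv (Pi.basisFun K (Fin n)))
  have hb : ∀ i, ∃ χ : G →* Kˣ, ∀ g, ρ g (b i) = (χ g : K) • b i := fun i =>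
    Module.Basis.ofSpan_subset hspan
      (by rw [Module.Basis.reindex_apply]; exact Set.mem_range_self _)
  choose χ hχ using hb
  let P := (Pi.basisFun K (Fin n)).toMatrix b
  let Q := b.toMatrix (Pi.basisFun K (Fin n))
  have hPQ : P * Q = 1 := Module.Basis.toMatrix_mul_toMatrix_flip _ _
  have hQP : Q * P = 1 := Module.Basis.toMatrix_mul_toMatrix_flip _ _
  refine ⟨P, Q, χ, hPQ, hQP, fun g => ?_⟩
  have h : (ψ g : Matrix (Fin n) (Fin n) K) * P = P * Matrix.diagonal (fun i => (χ i g : K)) := by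
    ext i j
    have := congrFun (hχ j g) i
    rw [hρ] at this
    rw [Matrix.mul_diagonal]
    simpa [P, Matrix.mulVec, dotProduct, Matrix.mul_apply, Module.Basis.toMatrix_apply,
      mul_comm] using this
  calc Q * (ψ g : Matrix (Fin n) (Fin n) K)
      = Q * ((ψ g : Matrix (Fin n) (Fin n) K) * P) * Q := by
        rw [mul_assoc, mul_assoc, hPQ, mul_one]
    _ = Matrix.diagonal (fun i => (χ i g : K)) * Q := by
        rw [h, ← mul_assoc, hQP, one_mul]

end Diagonalization

/-! ### Invariants of diagonal representations -/

section DiagonalRepresentation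

variable {F : Type*} [Field F] {G : Type*} [Group G] {n : ℕ}

/-- The representation of `G` on `F^n` by diagonal matrices with diagonal characters `χ i`. -/
def diagonalRep (χ : Fin n → G →* Fˣ) : G →* GL (Fin n) F :=
  (Units.map (Matrix.diagonalRingHom (Fin n) F).toMonoidHom).comp
    (MulEquiv.piUnits.symm.toMonoidHom.comp (MonoidHom.pi χ))

lemma coe_diagonalRep (χ : Fin n → G →* Fˣ) (g : G) :
    (diagonalRep χ g : Matrix (Fin n) (Fin n) F) = Matrix.diagonal fun i => (χ i g : F) := rfl

lemma prod_character_pow_eq_one_of_mem_support {χ : Fin n → G →* Fˣ}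
    {f : MvPolynomial (Fin n) F} (hf : f ∈ invariants (diagonalRep χ)) {a : Fin n →₀ ℕ}
    (ha : a ∈ f.support) (g : G) : ∏ i, χ i g ^ a i = 1 := by
  have h := congrArg (coeff a) (hf g⁻¹)
  rw [inv_inv, coe_diagonalRep, coeff_linSubst_diagonal] at h
  ext
  simpa using mul_right_cancel₀ (mem_support_iff.mp ha) (h.trans (one_mul _).symm)

end DiagonalRepresentation

/-! ### Comparison of split fields -/

section Comparison

variable {G : Type*} [CommGroup G]

/-- If the invariants of degree at most `d` separate orbits in every representation, then `d` is at
least the order of each character: otherwise `0` and `1` are not separated in the corresponding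
one-dimensional representation. -/
lemma orderOf_character_le {F : Type*} [Field F] (χ : G →* Fˣ) {d : ℕ}
    (h : IsSeparatingSet (diagonalRep fun _ : Fin 1 => χ)
      (invariantsLE (diagonalRep fun _ : Fin 1 => χ) d)) : orderOf χ ≤ d := by
  by_contra hlt
  obtain ⟨g, hg⟩ := h.2 1 0 fun f hf => by
    rw [eval_eq', eval_eq']
    refine Finset.sum_congr rfl fun a ha => ?_
    congr 1
    have ha0 : a 0 = 0 := by
      by_contra hne
      have hdvd : χ ^ a 0 = 1 := MonoidHom.ext fun g => by
        simpa using prod_character_pow_eq_one_of_mem_support hf.1 ha g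
      have h1 : a 0 ≤ d := by
        have := (le_totalDegree ha).trans hf.2
        rw [Finsupp.sum_fintype _ _ fun _ => rfl] at this
        simpa using this
      exact hlt ((orderOf_le_of_pow_eq_one (Nat.pos_of_ne_zero hne) hdvd).trans h1)
    simp [ha0]
  have := congrFun hg 0
  rw [coe_diagonalRep, Matrix.mulVec_diagonal] at this
  simp at this

/-- In the split non-modular case, after diagonalization, whether `v` and `w` are separated by
invariants of degree at most `d` or lie in one orbit depends only on the support of `v` and the
ratios `w i / v i`. These ratios are roots of unity of order dividing the exponent of `G`, hence
can be moved to any other field that has enough roots of unity. -/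
theorem betaSep_le_betaSep_of_hasEnoughRootsOfUnity [Finite G] (K F : Type*) [Field K] [Field F]
    [HasEnoughRootsOfUnity K (Monoid.exponent G)] [HasEnoughRootsOfUnity F (Monoid.exponent G)]
    (hK : (Nat.card G : K) ≠ 0) : betaSep K G ≤ betaSep F G := by
  classical
  refine betaSep_le_betaSep_of_forall fun d hd n ψ v w hvw => ?_
  obtain ⟨P, Q, χ, hPQ, hQP, hQ⟩ := exists_diagonalization hK ψ
  set e := Monoid.exponent G
  have he0 : NeZero e := ⟨Monoid.exponent_ne_zero_of_finite⟩
  let σ : rootsOfUnity e K ≃* rootsOfUnity e F := mulEquivOfCyclicCardEq (by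
    rw [HasEnoughRootsOfUnity.natCard_rootsOfUnity, HasEnoughRootsOfUnity.natCard_rootsOfUnity])
  have hpow : ∀ i, χ i ^ e = 1 := fun i => MonoidHom.ext fun g => by
    rw [MonoidHom.pow_apply, ← map_pow, Monoid.pow_exponent_eq_one, map_one, MonoidHom.one_apply]
  let χR : Fin n → G →* rootsOfUnity e K := fun i => (χ i).codRestrict _ fun g => by
    rw [mem_rootsOfUnity, ← MonoidHom.pow_apply, hpow, MonoidHom.one_apply]
  let χF : Fin n → G →* Fˣ := fun i =>
    (rootsOfUnity e F).subtype.comp (σ.toMonoidHom.comp (χR i))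
  have hχF : ∀ i g, χF i g = (σ (χR i g) : Fˣ) := fun i g => rfl
  have hχR : ∀ i g, ((χR i g : Kˣ) : K) = χ i g := fun i g => rfl
  -- A product of roots of unity is trivial over `F` if and only if it is so over `K`.
  have hσ : ∀ (z : Fin n → rootsOfUnity e K) (a : Fin n →₀ ℕ),
      ∏ i, ((σ (z i) : Fˣ) : F) ^ a i = 1 ↔ ∏ i, ((z i : Kˣ) : K) ^ a i = 1 := by
    intro z a
    have h1 : ∏ i, ((σ (z i) : Fˣ) : F) ^ a i = ((σ (∏ i, z i ^ a i) : Fˣ) : F) := by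
      simp [map_prod]
    have h2 : ∏ i, ((z i : Kˣ) : K) ^ a i = ((∏ i, z i ^ a i : rootsOfUnity e K) : Kˣ) := by
      simp
    rw [h1, h2, Units.val_eq_one, Units.val_eq_one, OneMemClass.coe_eq_one,
      OneMemClass.coe_eq_one, map_eq_one_iff σ σ.injective]
  -- The coordinates of `v` and `w` in an eigenbasis agree on all invariant monomials.
  have hmon : ∀ a : Fin n →₀ ℕ, a.sum (fun _ k => k) ≤ d → (∀ g, ∏ i, (χ i g : K) ^ a i = 1) →
      ∏ i, (Q *ᵥ v) i ^ a i = ∏ i, (Q *ᵥ w) i ^ a i := by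
    intro a had ha
    have hinv : linSubst Q (monomial a 1) ∈ invariantsLE ψ d := by
      refine ⟨fun g => ?_, (totalDegree_linSubst_le _ _).trans
        ((totalDegree_monomial_le _ _).trans had)⟩
      rw [linSubst_linSubst, hQ, ← linSubst_linSubst]
      congr 1
      ext b
      rw [coeff_linSubst_diagonal, coeff_monomial]
      split_ifs with hab
      · rw [← hab, ha, one_mul]
      · rw [mul_zero]
    have := hvw _ hinv
    rw [eval_linSubst, eval_linSubst, eval_monomial, eval_monomial, one_mul, one_mul,
      Finsupp.prod_fintype _ _ (by simp), Finsupp.prod_fintype _ _ (by simp)] at this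
    exact this
  set x := Q *ᵥ v with hx
  set y := Q *ᵥ w
  have hu : ∀ i, ∃ u : rootsOfUnity e K, y i = ((u : Kˣ) : K) * x i := by
    intro i
    have hm : orderOf (χF i) ≤ d := orderOf_character_le _ (hd 1 _)
    have hme : orderOf (χF i) ∣ e := orderOf_dvd_of_pow_eq_one <| MonoidHom.ext fun g => by
      rw [MonoidHom.pow_apply, ← map_pow, Monoid.pow_exponent_eq_one, map_one, MonoidHom.one_apply]
    have hm0 : orderOf (χF i) ≠ 0 := fun h0 => he0.out (Nat.eq_zero_of_zero_dvd (h0 ▸ hme))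
    have hxy : x i ^ orderOf (χF i) = y i ^ orderOf (χF i) := by
      have hprod : ∀ z : Fin n → K, ∏ j, z j ^ (Finsupp.single i (orderOf (χF i))) j =
          z i ^ orderOf (χF i) := fun z => by
        rw [Finset.prod_eq_single i] <;> simp +contextual [eq_comm]
      rw [← hprod, ← hprod]
      refine hmon _ (by simpa using hm) fun g => ?_
      refine (hσ (fun j => χR j g) _).mp ?_
      rw [Finset.prod_eq_single i]
      · rw [Finsupp.single_eq_same, ← hχF, ← Units.val_pow_eq_pow_val, ← MonoidHom.pow_apply,
          pow_orderOf_eq_one]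
        rfl
      · intro j _ hj
        rw [Finsupp.single_eq_of_ne (by simpa using hj), pow_zero]
      · simp
    by_cases hxi : x i = 0
    · refine ⟨1, ?_⟩
      rw [hxi, zero_pow hm0] at hxy
      rw [hxi, mul_zero]
      exact pow_eq_zero_iff hm0 |>.mp hxy.symm
    · have hyi : y i ≠ 0 := fun h0 => by
        rw [h0, zero_pow hm0] at hxy
        exact hxi (pow_eq_zero_iff hm0 |>.mp hxy)
      refine ⟨⟨Units.mk0 (y i / x i) (div_ne_zero hyi hxi), ?_⟩, ?_⟩
      · obtain ⟨k, hk⟩ := hme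
        rw [mem_rootsOfUnity]
        ext
        simp only [Units.val_pow_eq_pow_val, Units.val_mk0, Units.val_one]
        rw [hk, pow_mul, div_pow, hxy, div_self (pow_ne_zero _ hyi), one_pow]
      · simp [hxi]
  choose u hu using hu
  -- The pair over `F` with the same support and the same ratios.
  let xF : Fin n → F := fun i => if x i = 0 then 0 else 1
  obtain ⟨g, hg⟩ := (hd n (diagonalRep χF)).2 xF (fun i => ((σ (u i) : Fˣ) : F) * xF i)
    fun f hf => by
      rw [eval_eq', eval_eq']
      refine Finset.sum_congr rfl fun a ha => ?_
      congr 1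
      by_cases hsupp : ∃ i, a i ≠ 0 ∧ x i = 0
      · obtain ⟨i, hai, hxi⟩ := hsupp
        rw [Finset.prod_eq_zero (Finset.mem_univ i), Finset.prod_eq_zero (Finset.mem_univ i)] <;>
          simp [xF, hxi, hai]
      · push Not at hsupp
        have hne : ∏ i, x i ^ a i ≠ 0 := Finset.prod_ne_zero_iff.mpr fun i _ => by
          by_cases hai : a i = 0
          · simp [hai]
          · exact pow_ne_zero _ (hsupp i hai)
        have hmon' := hmon a ((le_totalDegree ha).trans hf.2) fun g => by
          have := congrArg Units.val (prod_character_pow_eq_one_of_mem_support hf.1 ha g)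
          rw [Units.coe_prod] at this
          exact (hσ (fun i => χR i g) a).mp (by simpa [hχF] using this)
        simp only [hu, mul_pow, Finset.prod_mul_distrib] at hmon' ⊢
        rw [(hσ u a).mpr (mul_right_cancel₀ hne (hmon'.symm.trans (one_mul _).symm)), one_mul]
  refine ⟨g, ?_⟩
  have hgx : Matrix.diagonal (fun i => (χ i g : K)) *ᵥ x = y := by
    ext i
    rw [Matrix.mulVec_diagonal, hu]
    by_cases hxi : x i = 0
    · simp [hxi]
    · congr 1
      have := congrFun hg i
      rw [coe_diagonalRep, Matrix.mulVec_diagonal] at this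
      have h1 : ((σ (χR i g) : Fˣ) : F) = (σ (u i) : Fˣ) := by simpa [xF, hxi, hχF] using this
      rw [← hχR, σ.injective (Subtype.ext (Units.ext h1))]
  calc (ψ g : Matrix (Fin n) (Fin n) K) *ᵥ v
      = P *ᵥ ((Q * (ψ g : Matrix (Fin n) (Fin n) K)) *ᵥ v) := by
        rw [Matrix.mulVec_mulVec, ← mul_assoc, hPQ, one_mul]
    _ = P *ᵥ (Q *ᵥ w) := by rw [hQ, ← Matrix.mulVec_mulVec, ← hx, hgx]
    _ = w := by rw [Matrix.mulVec_mulVec, hPQ, Matrix.one_mulVec]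

end Comparison

end SepNoether
end

theorem proposition2p5 {K : Type*} [Field K] {G : Type*} [CommGroup G] [Finite G]
    (hK : (Nat.card G : K) ≠ 0) :
    SepNoether.betaSep K G ≤ SepNoether.betaSep ℂ G ∧
      ((∃ ζ : Kˣ, orderOf ζ = Monoid.exponent G) →
        SepNoether.betaSep K G = SepNoether.betaSep ℂ G) := by
  have he : Monoid.exponent G ≠ 0 := Monoid.exponent_ne_zero_of_finite
  have : NeZero (Monoid.exponent G) := ⟨he⟩
  have hKe : (Monoid.exponent G : K) ≠ 0 := fun h0 => by
    obtain ⟨k, hk⟩ := Group.exponent_dvd_nat_card (G := G)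
    exact hK (by rw [hk, Nat.cast_mul, h0, zero_mul])
  have : NeZero (Monoid.exponent G : K) := ⟨hKe⟩
  have : NeZero (Monoid.exponent G : ℂ) := ⟨Nat.cast_ne_zero.mpr he⟩
  have hℂ : (Nat.card G : ℂ) ≠ 0 := Nat.cast_ne_zero.mpr Nat.card_pos.ne'
  have hK' : (Nat.card G : AlgebraicClosure K) ≠ 0 := by
    rw [← map_natCast (algebraMap K (AlgebraicClosure K))]
    exact (map_ne_zero _).mpr hK
  have hle := (SepNoether.betaSep_le_betaSep_of_algebra K (AlgebraicClosure K) hK).trans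
    (SepNoether.betaSep_le_betaSep_of_hasEnoughRootsOfUnity (G := G) (AlgebraicClosure K) ℂ hK')
  refine ⟨hle, fun ⟨ζ, hζ⟩ => le_antisymm hle ?_⟩
  have : HasEnoughRootsOfUnity K (Monoid.exponent G) :=
    ⟨⟨ζ, IsPrimitiveRoot.coe_units_iff.mpr (hζ ▸ IsPrimitiveRoot.orderOf ζ)⟩,
      rootsOfUnity.isCyclic K _⟩
  exact SepNoether.betaSep_le_betaSep_of_hasEnoughRootsOfUnity ℂ K hℂ
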